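/- Consider $n$ pursuers in the plane and a stationary target at $(x_t,y_t)$. Pursuer $i$ has constant speed $V_i>0$, position $(x_i,y_i)$, heading $\gamma_i$ and lateral acceleration $a_i$, with unicycle kinematics $$\dot x_i=V_i\cos\gamma_i,\qquad \dot y_i=V_i\sin\gamma_i,\qquad \dot\gamma_i=a_i/V_i .$$ Let $R_i$ be its distance from the target and $\theta_i\in(-\pi,\pi]$ its lead angle, i.e. the signed angle from its heading direction to the line of sight to the target. Put $$a_i'=\frac{2V_i^2\sin\theta_i}{R_i},\qquad \tilde t_i=\frac{R_i\,\theta_i}{V_i\sin\theta_i};$$ $a_i'$ is the lateral acceleration that leads to the target on a circular path, and $\tilde t_i$, the estimated time of interception, is the time which that path takes. Assume $\theta_i(0)\notin\{0,\pi\}$ for all $i$. The communication graph is a switching digraph $\mathcal G(t)$ on the fixed node set $\{1,\dots,n\}$: there are instants $0=t_0<t_1<t_2<\cdots\to\infty$ such that $\mathcal G$ is constant on each $[t_z,t_{z+1})$. Let $\mathcal N_{out}(i)$ be the set of out-neighbours of $i$ in $\mathcal G(t)$. The guidance law is $$a_i=0\ \text{ if } \tilde t_i<\tilde t_j \text{ for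 some } j\in\mathcal N_{out}(i),\qquad a_i=a_i'\ \text{ if } \tilde t_i\ge \tilde t_j \text{ for all } j\in\mathcal N_{out}(i).$$ It is followed at almost every time until the first arrival of a pursuer at the target; positions are continuous, and the equation for $\gamma_i$ is understood in integrated form with $a_i$ locally integrable. Sliding motions are admitted as well: if $\tilde t_i\ge\tilde t_j$ for all $j\in\mathcal N_{out}(i)$, and if $i$ is joined by a directed path, along which all estimated times are equal, to a pursuer whose estimated time is strictly smaller than that of one of its own out-neighbours, then $a_i$ may be any value between $0$ and $a_i'$ (the average that results when the two rules alternate infinitely fast). Let $l$ be a leader, i.e. $\tilde t_l(0)=\max_{1\le i\le n}\tilde t_i(0)$, and suppose that $l$ is globally reachable in $\mathcal G(t)$ for all $t\ge0$, i.e. $\mathcal G(t)$ contains a directed path from every other node to $l$. Then for every such motion the pursuers intercept the target simultaneously: each of the $n$ pursuers reaches the target for the first time at $t_f=\tilde t_l(0)$. -/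

import Mathlib

open MeasureTheory Set Filter

/-- The data of an engagement of `n` pursuers with a stationary target: constant speeds `V`,
target position `(xT, yT)`, and, as functions of time, the positions `(x i, y i)`, the heading
angles `γ i` and the lateral accelerations `a i`. -/
structure Engagement (n : ℕ) where
  V : Fin n → ℝ
  xT : ℝ
  yT : ℝ
  x : Fin n → ℝ → ℝ
  y : Fin n → ℝ → ℝ
  γ : Fin n → ℝ → ℝ
  a : Fin n → ℝ → ℝ

/-- Node `l` is globally reachable: there is a directed path from every node to `l`. -/
def GloballyReachable {n : ℕ} (G : Digraph (Fin n)) (l : Fin n) : Prop :=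
  ∀ i, Relation.ReflTransGen G.Adj i l

/-- A switching graph on the fixed node set `Fin n`: there are switching instants
`0 = τ 0 < τ 1 < τ 2 < ...`, tending to infinity, such that the graph is static on every
`[τ z, τ (z + 1))`. -/
def IsSwitchingGraph {n : ℕ} (G : ℝ → Digraph (Fin n)) : Prop :=
  ∃ τ : ℕ → ℝ, τ 0 = 0 ∧ StrictMono τ ∧ Tendsto τ atTop atTop ∧
    ∀ z, ∀ t ∈ Ico (τ z) (τ (z + 1)), G t = G (τ z)

/-- For estimated times `s`: starting at `i` and following out-neighbours that all have the same
estimated time, one can get to a pursuer `j` whose estimated time is strictly below that of one of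
its out-neighbours (so that `j` moves on a straight line). -/
def TiedToLagging {n : ℕ} (G : Digraph (Fin n)) (s : Fin n → ℝ) (i : Fin n) : Prop :=
  ∃ j, Relation.ReflTransGen (fun p q => G.Adj p q ∧ s p = s q) i j ∧
    ∃ k, G.Adj j k ∧ s j < s k

/-- The guidance law at one instant, for the communication graph `G`, estimated times `s`,
accelerations `c` of the circular paths to the target, and applied lateral accelerations `a`.

* If `s i` is smaller than the maximum of `s j` over the out-neighbours `j` of `i`, then `a i = 0`.
* If `s i` is at least that maximum, then `a i = c i`.

At a tie of `i` with an out-neighbour that is itself being carried along by a straight line motion,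
the second rule is obeyed only momentarily: `i` drops below at once, returns, and so on, so that the
two rules alternate infinitely fast and `i` stays at the tie (sliding mode). The resulting
effective acceleration is an average of `0` and `c i`. The second alternative in the second rule
admits these motions too; it is never available to a pursuer that is not tied in this way. -/
def GuidanceLaw {n : ℕ} (G : Digraph (Fin n)) (s c a : Fin n → ℝ) : Prop :=
  ∀ i, ((∃ j, G.Adj i j ∧ s i < s j) → a i = 0) ∧
    ((∀ j, G.Adj i j → s j ≤ s i) →
      a i = c i ∨ (TiedToLagging G s i ∧ a i ∈ segment ℝ 0 (c i)))

namespace Engagement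

variable {n : ℕ} (E : Engagement n)

/-- The distance of pursuer `i` from the target. -/
noncomputable def range (i : Fin n) (t : ℝ) : ℝ :=
  √((E.xT - E.x i t) ^ 2 + (E.yT - E.y i t) ^ 2)

/-- The lead angle, in `(-π, π]`: the signed angle from the heading direction of pursuer `i` to
the line of sight to the target. -/
noncomputable def leadAngle (i : Fin n) (t : ℝ) : ℝ :=
  Complex.arg ((⟨E.xT - E.x i t, E.yT - E.y i t⟩ : ℂ) *
    Complex.exp (-(E.γ i t : ℂ) * Complex.I))

/-- The lateral acceleration that takes pursuer `i` to the target on a circular path. -/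
noncomputable def circularAccel (i : Fin n) (t : ℝ) : ℝ :=
  2 * E.V i ^ 2 * Real.sin (E.leadAngle i t) / E.range i t

/-- The estimated time of interception of pursuer `i`. -/
noncomputable def estTime (i : Fin n) (t : ℝ) : ℝ :=
  E.range i t * E.leadAngle i t / (E.V i * Real.sin (E.leadAngle i t))

/-- Pursuer `i` is at the target at time `t`. -/
def AtTarget (i : Fin n) (t : ℝ) : Prop :=
  E.x i t = E.xT ∧ E.y i t = E.yT

/-- The engagement is in progress at time `t`: nobody has reached the target up to time `t`. -/
def InProgress (t : ℝ) : Prop :=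
  ∀ s ∈ Icc 0 t, ∀ i, ¬ E.AtTarget i s

/-- The unicycle kinematics `x' = V cos γ`, `y' = V sin γ`, `γ' = a / V`, as long as the engagement
is in progress. Since `a` jumps, the last equation is in integrated form (Carathéodory). -/
structure Kinematics : Prop where
  x_cont : ∀ i, ContinuousOn (E.x i) (Ici 0)
  y_cont : ∀ i, ContinuousOn (E.y i) (Ici 0)
  x_deriv : ∀ i t, 0 ≤ t → E.InProgress t →
    HasDerivWithinAt (E.x i) (E.V i * Real.cos (E.γ i t)) (Ici 0) t
  y_deriv : ∀ i t, 0 ≤ t → E.InProgress t →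
    HasDerivWithinAt (E.y i) (E.V i * Real.sin (E.γ i t)) (Ici 0) t
  a_int : ∀ i t, 0 ≤ t → E.InProgress t → IntervalIntegrable (E.a i) volume 0 t
  γ_eq : ∀ i t, 0 ≤ t → E.InProgress t →
    E.γ i t = E.γ i 0 + ∫ s in (0 : ℝ)..t, E.a i s / E.V i

/-- As long as the engagement is in progress, the pursuers apply the guidance law over the
communication graph `G t`, at almost every time `t`. -/
def FollowsGuidanceLaw (G : ℝ → Digraph (Fin n)) : Prop :=
  ∀ᵐ t : ℝ, 0 ≤ t → E.InProgress t →
    GuidanceLaw (G t) (fun i => E.estTime i t) (fun i => E.circularAccel i t) (fun i => E.a i t)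

/-- Pursuer `l` is a leader at time `t`: it has the largest estimated time of interception. -/
def IsLeaderAt (l : Fin n) (t : ℝ) : Prop :=
  ∀ i, E.estTime i t ≤ E.estTime l t

/-- Pursuer `i` intercepts the target at time `t`, and not before. -/
def InterceptsAt (i : Fin n) (t : ℝ) : Prop :=
  0 ≤ t ∧ E.AtTarget i t ∧ ∀ s ∈ Ico 0 t, ¬ E.AtTarget i s

end Engagement

/-! Let `p` be the cosine of the lead angle, `R` the range, and `F = interceptFactor` the
arc-to-chord ratio, so that the estimated time is `R * F p / V`. Write the applied acceleration as
`μ` times the circular one: `μ = 0` is straight flight, `μ = 1` the circle, and sliding motions lie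
in between. Almost everywhere the estimated time plus elapsed time has derivative `(2 - 2 * μ) * (1
- p * F p)`. It is nonnegative because `θ ≤ tan θ`, and it vanishes for `μ = 1`.

A pursuer of maximal estimated time has `μ = 1`, so the maximum of these sums never exceeds its
initial value `t_f`. An arc is no shorter than its chord, so `R ≤ V * (t_f - t)` as long as nobody
has arrived. Hence some arrival takes place by `t_f`, and if none takes place earlier, all pursuers
arrive together at `t_f`.

Suppose the first arrival were at `T < t_f`. An arriving pursuer has estimated time tending to zero,
whereas the leader's is at least `t_f - t`, so the leader is not among the arrivals. Just before `T`
the graph is constant and contains a path from an arriving pursuer to the leader, hence an edge from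
an arriving `i` to a non-arriving `k`. Near `T` the estimated time of `i` is below that of `k`, so
`i` flies straight. But straight flight preserves the nonzero miss distance `R * |sin θ|`, so `i`
cannot arrive. -/

/-! ### Absolutely continuous functions: monotonicity and the maximum of a family -/

section AbsoluteContinuity

/-- A function whose oscillation is dominated by that of an absolutely continuous function is
absolutely continuous. -/
theorem AbsolutelyContinuousOnInterval.of_dist_le {X Y : Type*} [PseudoMetricSpace X]
    [PseudoMetricSpace Y] {f : ℝ → X} {g : ℝ → Y} {a b K : ℝ}
    (hg : AbsolutelyContinuousOnInterval g a b)
    (h : ∀ x ∈ uIcc a b, ∀ y ∈ uIcc a b, dist (f x) (f y) ≤ K * dist (g x) (g y)) :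
    AbsolutelyContinuousOnInterval f a b := by
  unfold AbsolutelyContinuousOnInterval at hg ⊢
  have hK := hg.const_mul K
  rw [mul_zero] at hK
  refine tendsto_of_tendsto_of_tendsto_of_le_of_le' tendsto_const_nhds hK
    (Eventually.of_forall fun E => Finset.sum_nonneg fun i _ => dist_nonneg) ?_
  refine eventually_inf_principal.2 (Eventually.of_forall fun E hE => ?_)
  rw [Finset.mul_sum]
  exact Finset.sum_le_sum fun i hi => h _ (hE.1 i hi).1 _ (hE.1 i hi).2

/-- Composition of a continuously differentiable function with an absolutely continuous one. -/
theorem AbsolutelyContinuousOnInterval.contDiffOn_comp {f h : ℝ → ℝ} {a b : ℝ} {U : Set ℝ}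
    (hf : AbsolutelyContinuousOnInterval f a b) (hU : U.OrdConnected)
    (hh : ContDiffOn ℝ 1 h U) (hfU : ∀ x ∈ uIcc a b, f x ∈ U) :
    AbsolutelyContinuousOnInterval (fun x => h (f x)) a b := by
  obtain ⟨x₀, hx₀, hmin⟩ := isCompact_uIcc.exists_isMinOn nonempty_uIcc hf.continuousOn
  obtain ⟨x₁, hx₁, hmax⟩ := isCompact_uIcc.exists_isMaxOn nonempty_uIcc hf.continuousOn
  have hsub : Icc (f x₀) (f x₁) ⊆ U := hU.out (hfU _ hx₀) (hfU _ hx₁)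
  obtain ⟨K, hK⟩ := (hh.mono hsub).exists_lipschitzOnWith (by decide) (convex_Icc _ _)
    isCompact_Icc
  exact hf.of_dist_le fun x hx y hy =>
    hK.dist_le_mul _ ⟨hmin hx, hmax hx⟩ _ ⟨hmin hy, hmax hy⟩

theorem AbsolutelyContinuousOnInterval.finset_sum {ι : Type*} {f : ι → ℝ → ℝ} {a b : ℝ}
    (s : Finset ι) (hf : ∀ i ∈ s, AbsolutelyContinuousOnInterval (f i) a b) :
    AbsolutelyContinuousOnInterval (fun x => ∑ i ∈ s, f i x) a b := by
  classical
  induction s using Finset.induction_on with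
  | empty =>
    simpa using (LipschitzWith.const (0 : ℝ)).lipschitzOnWith.absolutelyContinuousOnInterval
  | insert i s hi ih =>
    simp only [Finset.sum_insert hi]
    exact (hf i (Finset.mem_insert_self _ _)).fun_add
      (ih fun j hj => hf j (Finset.mem_insert_of_mem hj))

theorem ae_restrict_Icc_of_ae_Ioo {a b : ℝ} {P : ℝ → Prop} (h : ∀ᵐ t, t ∈ Ioo a b → P t) :
    ∀ᵐ t ∂volume.restrict (Icc a b), P t := by
  rw [← restrict_Ioo_eq_restrict_Icc]
  exact (ae_restrict_iff' measurableSet_Ioo).2 h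

/-- An absolutely continuous function with almost everywhere nonnegative derivative increases. -/
theorem AbsolutelyContinuousOnInterval.le_of_ae_hasDerivAt_nonneg {f : ℝ → ℝ} {a b : ℝ}
    (hf : AbsolutelyContinuousOnInterval f a b) (hab : a ≤ b)
    (h : ∀ᵐ t, t ∈ Ioo a b → ∃ d, 0 ≤ d ∧ HasDerivAt f d t) : f a ≤ f b := by
  rw [← sub_nonneg, ← hf.integral_deriv_eq_sub]
  refine intervalIntegral.integral_nonneg_of_ae_restrict hab ?_
  filter_upwards [ae_restrict_Icc_of_ae_Ioo h] with t ⟨d, hd, ht⟩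
  simpa [ht.deriv] using hd

theorem AbsolutelyContinuousOnInterval.monotoneOn_of_ae_hasDerivAt_nonneg {f : ℝ → ℝ} {a b : ℝ}
    (hf : AbsolutelyContinuousOnInterval f a b)
    (h : ∀ᵐ t, t ∈ Ioo a b → ∃ d, 0 ≤ d ∧ HasDerivAt f d t) : MonotoneOn f (Icc a b) := by
  intro x hx y hy hxy
  refine (hf.mono ?_).le_of_ae_hasDerivAt_nonneg hxy ?_
  · rw [uIcc_of_le hxy, uIcc_of_le (hx.1.trans (hxy.trans hy.2))]
    exact Icc_subset_Icc hx.1 hy.2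
  · filter_upwards [h] with t ht htx
    exact ht ⟨hx.1.trans_lt htx.1, htx.2.trans_le hy.2⟩

/-- If every member of a finite family of increasing absolutely continuous functions is almost
everywhere stationary whenever it is maximal in the family, then no member exceeds the
initial maximum. -/
theorem le_of_ae_stationary_of_maximal {ι : Type*} [Fintype ι] {g : ι → ℝ → ℝ} {a b C : ℝ}
    (hab : a ≤ b) (hg : ∀ i, AbsolutelyContinuousOnInterval (g i) a b)
    (hmono : ∀ i, MonotoneOn (g i) (Icc a b))
    (h : ∀ᵐ t, t ∈ Ioo a b → ∀ i, (∀ j, g j t ≤ g i t) → HasDerivAt (g i) 0 t)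
    (hC : ∀ i, g i a ≤ C) (i : ι) : g i b ≤ C := by
  have : Nonempty ι := ⟨i⟩
  set M : ℝ → ℝ := fun t => Finset.univ.sup' Finset.univ_nonempty fun i => g i t with hM
  have hle : ∀ j t, g j t ≤ M t := fun j t =>
    Finset.le_sup' (fun i => g i t) (Finset.mem_univ j)
  have hex : ∀ t, ∃ j, M t = g j t := fun t => by
    obtain ⟨j, -, hj⟩ := Finset.exists_mem_eq_sup' Finset.univ_nonempty fun i => g i t
    exact ⟨j, hj⟩
  have hMac : AbsolutelyContinuousOnInterval M a b := by
    -- Since every member increases, an increment of the maximum is at most the increment of a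
    -- single member, hence at most that of the sum.
    refine (AbsolutelyContinuousOnInterval.finset_sum Finset.univ fun i _ => hg i).of_dist_le
      (K := 1) ?_
    have key : ∀ x ∈ Icc a b, ∀ y ∈ Icc a b, x ≤ y →
        dist (M x) (M y) ≤ 1 * dist (∑ i, g i x) (∑ i, g i y) := by
      intro x hx y hy hxy
      rw [one_mul, dist_comm, dist_comm (∑ i, g i x), Real.dist_eq, Real.dist_eq,
        ← Finset.sum_sub_distrib]
      have hnn : ∀ j, 0 ≤ g j y - g j x := fun j => sub_nonneg.2 (hmono j hx hy hxy)
      rw [abs_of_nonneg (Finset.sum_nonneg fun j _ => hnn j)]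
      obtain ⟨j, hj⟩ := hex x
      obtain ⟨k, hk⟩ := hex y
      have h1 : M x ≤ M y := by rw [hj]; linarith [hnn j, hle j y]
      have h2 := Finset.single_le_sum (fun j _ => hnn j) (Finset.mem_univ k)
      rw [abs_of_nonneg (sub_nonneg.2 h1)]
      linarith [hle k x]
    rw [uIcc_of_le hab]
    intro x hx y hy
    rcases le_total x y with hxy | hxy
    · exact key x hx y hy hxy
    · rw [dist_comm, dist_comm (∑ i, g i x)]
      exact key y hy x hx hxy
  have hMd : ∀ᵐ t, t ∈ Ioo a b → ∃ d : ℝ, 0 ≤ d ∧ HasDerivAt (fun t => -M t) d t := by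
    filter_upwards [h, hMac.ae_differentiableAt] with t ht htd hmem
    obtain ⟨j, hj⟩ := hex t
    have hd := (htd (by rw [uIcc_of_le hab]; exact Ioo_subset_Icc_self hmem)).hasDerivAt
    have hj' := ht hmem j fun k => hj ▸ hle k t
    -- The maximum touches `g j` from above at `t`, so both have the same derivative there, namely
    -- zero.
    have hmin : IsLocalMin (fun s => M s - g j s) t :=
      Eventually.of_forall fun s => by simpa [hj] using hle j s
    have h0 := hmin.hasDerivAt_eq_zero (hd.sub hj')
    rw [sub_zero] at h0
    exact ⟨-deriv M t, by rw [h0, neg_zero], hd.fun_neg⟩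
  have := hMac.fun_neg.le_of_ae_hasDerivAt_nonneg hab hMd
  obtain ⟨j, hj⟩ := hex a
  linarith [hle i b, hC j]

end AbsoluteContinuity

/-! ### The arc-to-chord ratio -/

section InterceptFactor

/-- The ratio of the length of a circular arc to its chord, as a function of the cosine of the
angle between the chord and the tangent. -/
noncomputable def interceptFactor (p : ℝ) : ℝ := Real.arccos p / √(1 - p ^ 2)

theorem one_sub_sq_pos {p : ℝ} (hp : p ∈ Ioo (-1 : ℝ) 1) : 0 < 1 - p ^ 2 := by
  nlinarith [hp.1, hp.2]

theorem contDiffOn_interceptFactor : ContDiffOn ℝ 1 interceptFactor (Ioo (-1) 1) := by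
  refine ContDiffOn.div ?_ ?_ ?_
  · exact fun p hp => (Real.contDiffAt_arccos hp.1.ne' hp.2.ne).contDiffWithinAt
  · exact ContDiffOn.sqrt (by fun_prop) fun p hp => (one_sub_sq_pos hp).ne'
  · exact fun p hp => (Real.sqrt_pos.2 (one_sub_sq_pos hp)).ne'

/-- Writing the derivative through the function itself lets the factor `1 - p ^ 2` cancel against
the derivative of the cosine of the lead angle. -/
theorem hasDerivAt_interceptFactor {p : ℝ} (hp : p ∈ Ioo (-1 : ℝ) 1) :
    HasDerivAt interceptFactor ((p * interceptFactor p - 1) / (1 - p ^ 2)) p := by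
  have h0 := one_sub_sq_pos hp
  have h1 := Real.sqrt_pos.2 h0
  have hs : HasDerivAt (fun p : ℝ => √(1 - p ^ 2)) (-(2 * p) / (2 * √(1 - p ^ 2))) p := by
    have : HasDerivAt (fun p : ℝ => 1 - p ^ 2) (-(2 * p)) p := by
      simpa using ((hasDerivAt_id p).pow 2).const_sub 1
    exact this.sqrt h0.ne'
  refine ((Real.hasDerivAt_arccos hp.1.ne' hp.2.ne).fun_div hs h1.ne').congr_deriv ?_
  unfold interceptFactor
  have h2 := Real.sq_sqrt h0.le
  rw [h2]
  congr 1
  field_simp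
  ring

/-- This is `sin θ ≤ θ`; it bounds the range by speed times estimated time. -/
theorem one_le_interceptFactor {p : ℝ} (hp : p ∈ Ioo (-1 : ℝ) 1) : 1 ≤ interceptFactor p := by
  rw [interceptFactor, one_le_div (Real.sqrt_pos.2 (one_sub_sq_pos hp)), ← Real.sin_arccos]
  exact Real.sin_le (Real.arccos_nonneg p)

/-- For acute angles this is `θ < tan θ`; otherwise the left side is nonpositive. It makes estimated
plus elapsed time increase. -/
theorem mul_interceptFactor_le_one {p : ℝ} (hp : p ∈ Ioo (-1 : ℝ) 1) :
    p * interceptFactor p ≤ 1 := by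
  rcases le_or_gt p 0 with h | h
  · nlinarith [one_le_interceptFactor hp]
  · rw [interceptFactor, ← mul_div_assoc, div_le_one (Real.sqrt_pos.2 (one_sub_sq_pos hp)),
      ← Real.sin_arccos]
    have hc : Real.cos (Real.arccos p) = p := Real.cos_arccos hp.1.le hp.2.le
    have := Real.lt_tan (Real.arccos_pos.2 hp.2) (Real.arccos_lt_pi_div_two.2 h)
    rw [Real.tan_eq_sin_div_cos, hc, lt_div_iff₀ h] at this
    linarith

/-- Jordan's inequality. A pursuer near the target and heading towards it therefore has a small
estimated time. -/
theorem interceptFactor_le_pi_div_two {p : ℝ} (hp : p ∈ Ico (0 : ℝ) 1) :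
    interceptFactor p ≤ Real.pi / 2 := by
  have hp' : p ∈ Ioo (-1 : ℝ) 1 := ⟨by linarith [hp.1], hp.2⟩
  rw [interceptFactor, div_le_iff₀ (Real.sqrt_pos.2 (one_sub_sq_pos hp')), ← Real.sin_arccos]
  have h1 := Real.mul_le_sin (Real.arccos_nonneg p) (Real.arccos_le_pi_div_two.2 hp.1)
  calc Real.arccos p = Real.pi / 2 * (2 / Real.pi * Real.arccos p) := by
        field_simp
    _ ≤ _ := by gcongr

/-- For angles in `[-π, π]` the arc to chord ratio is an even function of the angle. -/
theorem interceptFactor_cos {θ : ℝ} (h₁ : -Real.pi ≤ θ) (h₂ : θ ≤ Real.pi) :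
    interceptFactor (Real.cos θ) = θ / Real.sin θ := by
  wlog h : 0 ≤ θ generalizing θ
  · have := this (θ := -θ) (by linarith) (by linarith) (by linarith)
    rwa [Real.cos_neg, Real.sin_neg, neg_div_neg_eq] at this
  · rw [interceptFactor, ← Real.abs_sin_eq_sqrt_one_sub_cos_sq, Real.arccos_cos h h₂,
      abs_of_nonneg (Real.sin_nonneg_of_nonneg_of_le_pi h h₂)]

end InterceptFactor

theorem AbsolutelyContinuousOnInterval.congr {X : Type*} [PseudoMetricSpace X] {f g : ℝ → X}
    {a b : ℝ} (hg : AbsolutelyContinuousOnInterval g a b) (h : EqOn f g (uIcc a b)) :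
    AbsolutelyContinuousOnInterval f a b :=
  hg.of_dist_le (K := 1) fun x hx y hy => by rw [h hx, h hy, one_mul]

/-- A function with bounded one-sided derivative is absolutely continuous. -/
theorem absolutelyContinuousOnInterval_of_hasDerivWithinAt_Ici {f f' : ℝ → ℝ} {b K : ℝ}
    (hb : 0 ≤ b) (hf : ∀ t ∈ Icc 0 b, HasDerivWithinAt f (f' t) (Ici 0) t)
    (hK : ∀ t ∈ Icc 0 b, |f' t| ≤ K) : AbsolutelyContinuousOnInterval f 0 b := by
  rw [← uIcc_of_le hb] at hf hK
  refine LipschitzOnWith.absolutelyContinuousOnInterval (K := K.toNNReal) ?_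
  refine (convex_uIcc 0 b).lipschitzOnWith_of_nnnorm_hasDerivWithin_le
    (fun t ht => (hf t ht).mono ?_) fun t ht => ?_
  · rw [uIcc_of_le hb]; exact Icc_subset_Ici_self
  · rw [← NNReal.coe_le_coe, coe_nnnorm, Real.norm_eq_abs]
    exact (hK t ht).trans (Real.le_coe_toNNReal K)

/-! ### Range and lead angle along a motion -/

namespace Engagement

variable {n : ℕ} {E : Engagement n} {i : Fin n} {t b : ℝ}

theorem InProgress.mono {s t : ℝ} (h : E.InProgress t) (hst : s ≤ t) : E.InProgress s :=
  fun r hr => h r ⟨hr.1, hr.2.trans hst⟩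

theorem range_eq_zero_iff : E.range i t = 0 ↔ E.AtTarget i t := by
  rw [range, Real.sqrt_eq_zero (by positivity), AtTarget]
  constructor
  · intro h
    constructor <;> nlinarith [sq_nonneg (E.xT - E.x i t), sq_nonneg (E.yT - E.y i t)]
  · rintro ⟨h1, h2⟩
    simp [h1, h2]

theorem range_nonneg : 0 ≤ E.range i t := Real.sqrt_nonneg _

theorem range_pos (h : ¬ E.AtTarget i t) : 0 < E.range i t :=
  range_nonneg.lt_of_ne fun h0 => h (range_eq_zero_iff.1 h0.symm)

theorem InProgress.range_pos (h : E.InProgress t) (ht : 0 ≤ t) : 0 < E.range i t :=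
  Engagement.range_pos (h t ⟨ht, le_rfl⟩ i)

theorem Kinematics.continuousOn_range (hkin : E.Kinematics) : ContinuousOn (E.range i) (Ici 0) :=
  (((continuousOn_const.sub (hkin.x_cont i)).pow 2).add
    ((continuousOn_const.sub (hkin.y_cont i)).pow 2)).sqrt

theorem range_mul_cos_leadAngle : E.range i t * Real.cos (E.leadAngle i t) =
    (E.xT - E.x i t) * Real.cos (E.γ i t) + (E.yT - E.y i t) * Real.sin (E.γ i t) := by
  have hn : ‖(⟨E.xT - E.x i t, E.yT - E.y i t⟩ : ℂ) *
      Complex.exp (-(E.γ i t : ℂ) * Complex.I)‖ = E.range i t := by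
    rw [norm_mul, ← Complex.ofReal_neg, Complex.norm_exp_ofReal_mul_I, mul_one,
      Complex.norm_eq_sqrt_sq_add_sq, range]
  rw [leadAngle, ← hn, Complex.norm_mul_cos_arg, ← Complex.ofReal_neg, Complex.mul_re,
    Complex.exp_ofReal_mul_I_re, Complex.exp_ofReal_mul_I_im, Real.cos_neg, Real.sin_neg]
  ring

theorem range_mul_sin_leadAngle : E.range i t * Real.sin (E.leadAngle i t) =
    (E.yT - E.y i t) * Real.cos (E.γ i t) - (E.xT - E.x i t) * Real.sin (E.γ i t) := by
  have hn : ‖(⟨E.xT - E.x i t, E.yT - E.y i t⟩ : ℂ) *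
      Complex.exp (-(E.γ i t : ℂ) * Complex.I)‖ = E.range i t := by
    rw [norm_mul, ← Complex.ofReal_neg, Complex.norm_exp_ofReal_mul_I, mul_one,
      Complex.norm_eq_sqrt_sq_add_sq, range]
  rw [leadAngle, ← hn, Complex.norm_mul_sin_arg, ← Complex.ofReal_neg, Complex.mul_im,
    Complex.exp_ofReal_mul_I_re, Complex.exp_ofReal_mul_I_im, Real.cos_neg, Real.sin_neg]
  ring

/-- The cosine of the lead angle. -/
noncomputable def cosLead (E : Engagement n) (i : Fin n) (t : ℝ) : ℝ :=
  Real.cos (E.leadAngle i t)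

theorem cosLead_mem_Icc : E.cosLead i t ∈ Icc (-1 : ℝ) 1 :=
  ⟨Real.neg_one_le_cos _, Real.cos_le_one _⟩

theorem sin_leadAngle_sq : Real.sin (E.leadAngle i t) ^ 2 = 1 - E.cosLead i t ^ 2 :=
  Real.sin_sq _

/-- The cosine of the lead angle, unlike the angle, has no branch cut, so all calculus is done with
it. In the degenerate case of zero sine both sides are zero, by division by zero. -/
theorem estTime_eq :
    E.estTime i t = E.range i t * interceptFactor (E.cosLead i t) / E.V i := by
  rw [estTime, cosLead,
    interceptFactor_cos (θ := E.leadAngle i t) (Complex.neg_pi_lt_arg _).le (Complex.arg_le_pi _),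
    mul_div_assoc', div_div, mul_comm (E.V i)]

theorem cosLead_zero_mem_Ioo (h : E.leadAngle i 0 ≠ 0 ∧ E.leadAngle i 0 ≠ Real.pi) :
    E.cosLead i 0 ∈ Ioo (-1 : ℝ) 1 := by
  have h1 : -Real.pi < E.leadAngle i 0 := Complex.neg_pi_lt_arg _
  have h2 : E.leadAngle i 0 < Real.pi := (Complex.arg_le_pi _).lt_of_ne h.2
  have hs : Real.sin (E.leadAngle i 0) ≠ 0 := fun h0 =>
    h.1 ((Real.sin_eq_zero_iff_of_lt_of_lt h1 h2).1 h0)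
  have := (sin_leadAngle_sq (E := E) (i := i) (t := 0)) ▸ (sq_pos_of_ne_zero hs)
  constructor <;> nlinarith [cosLead_mem_Icc (E := E) (i := i) (t := 0) |>.1,
    cosLead_mem_Icc (E := E) (i := i) (t := 0) |>.2]

theorem Kinematics.hasDerivWithinAt_range (hkin : E.Kinematics) (ht : 0 ≤ t)
    (hp : E.InProgress t) :
    HasDerivWithinAt (E.range i) (-(E.V i * E.cosLead i t)) (Ici 0) t := by
  have hR := hp.range_pos (i := i) ht
  have hne : (E.xT - E.x i t) ^ 2 + (E.yT - E.y i t) ^ 2 ≠ 0 :=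
    (Real.sqrt_pos.1 hR).ne'
  have h1 := ((hkin.x_deriv i t ht hp).const_sub E.xT).pow 2
  have h2 := ((hkin.y_deriv i t ht hp).const_sub E.yT).pow 2
  refine ((h1.add h2).sqrt hne).congr_deriv ?_
  have hc := range_mul_cos_leadAngle (E := E) (i := i) (t := t)
  change _ = -(E.V i * Real.cos (E.leadAngle i t))
  change _ / (2 * E.range i t) = _
  rw [div_eq_iff (by positivity)]
  push_cast
  linear_combination (2 * E.V i) * hc

theorem Kinematics.absolutelyContinuous_range (hkin : E.Kinematics) (hV : ∀ i, 0 < E.V i)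
    (hb : 0 ≤ b) (hp : E.InProgress b) : AbsolutelyContinuousOnInterval (E.range i) 0 b := by
  refine absolutelyContinuousOnInterval_of_hasDerivWithinAt_Ici (K := E.V i) hb
    (fun t ht => hkin.hasDerivWithinAt_range ht.1 (hp.mono ht.2)) fun t _ => ?_
  rw [abs_neg, abs_mul, abs_of_pos (hV i)]
  exact mul_le_of_le_one_right (hV i).le (Real.abs_cos_le_one _)

theorem Kinematics.absolutelyContinuous_γ (hkin : E.Kinematics)
    (hb : 0 ≤ b) (hp : E.InProgress b) : AbsolutelyContinuousOnInterval (E.γ i) 0 b := by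
  have h1 := ((hkin.a_int i b hb hp).div_const
    (E.V i)).absolutelyContinuousOnInterval_intervalIntegral left_mem_uIcc
  refine h1.of_dist_le (K := 1) ?_
  rw [uIcc_of_le hb]
  intro x hx y hy
  rw [hkin.γ_eq i x hx.1 (hp.mono hx.2), hkin.γ_eq i y hy.1 (hp.mono hy.2), dist_add_left,
    one_mul]

theorem Kinematics.ae_hasDerivAt_γ (hkin : E.Kinematics) (hb : 0 ≤ b) (hp : E.InProgress b) :
    ∀ᵐ t, t ∈ Ioo 0 b → HasDerivAt (E.γ i) (E.a i t / E.V i) t := by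
  filter_upwards [((hkin.a_int i b hb hp).div_const (E.V i)).ae_hasDerivAt_integral] with t ht hm
  have h := (ht (by rw [uIcc_of_le hb]; exact Ioo_subset_Icc_self hm) 0
    left_mem_uIcc).const_add (E.γ i 0)
  refine h.congr_of_eventuallyEq ?_
  filter_upwards [Ioo_mem_nhds hm.1 hm.2] with s hs
  exact hkin.γ_eq i s hs.1.le (hp.mono hs.2.le)

theorem cosLead_eq (hR : 0 < E.range i t) : E.cosLead i t =
    ((E.xT - E.x i t) * Real.cos (E.γ i t) + (E.yT - E.y i t) * Real.sin (E.γ i t)) *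
      (E.range i t)⁻¹ := by
  rw [← range_mul_cos_leadAngle, cosLead]
  field_simp

theorem Kinematics.absolutelyContinuous_cosLead (hkin : E.Kinematics) (hV : ∀ i, 0 < E.V i)
    (hb : 0 ≤ b) (hp : E.InProgress b) : AbsolutelyContinuousOnInterval (E.cosLead i) 0 b := by
  have hγ := hkin.absolutelyContinuous_γ (i := i) hb hp
  have hc := hγ.contDiffOn_comp ordConnected_univ Real.contDiff_cos.contDiffOn
    fun _ _ => mem_univ _
  have hs := hγ.contDiffOn_comp ordConnected_univ Real.contDiff_sin.contDiffOn
    fun _ _ => mem_univ _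
  have hbd : ∀ r : ℝ, |r| ≤ 1 → |-(E.V i * r)| ≤ E.V i := fun r hr => by
    rw [abs_neg, abs_mul, abs_of_pos (hV i)]
    exact mul_le_of_le_one_right (hV i).le hr
  have hx : AbsolutelyContinuousOnInterval (fun t => E.xT - E.x i t) 0 b :=
    absolutelyContinuousOnInterval_of_hasDerivWithinAt_Ici hb
      (fun t ht => (hkin.x_deriv i t ht.1 (hp.mono ht.2)).const_sub E.xT)
      fun t _ => hbd _ (Real.abs_cos_le_one _)
  have hy : AbsolutelyContinuousOnInterval (fun t => E.yT - E.y i t) 0 b :=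
    absolutelyContinuousOnInterval_of_hasDerivWithinAt_Ici hb
      (fun t ht => (hkin.y_deriv i t ht.1 (hp.mono ht.2)).const_sub E.yT)
      fun t _ => hbd _ (Real.abs_sin_le_one _)
  have hpos : ∀ t ∈ uIcc 0 b, 0 < E.range i t := fun t ht => by
    rw [uIcc_of_le hb] at ht
    exact (hp.mono ht.2).range_pos ht.1
  have hinv := (hkin.absolutelyContinuous_range (i := i) hV hb hp).contDiffOn_comp
    (h := fun r => r⁻¹) (U := Ioi 0) ordConnected_Ioi
    (contDiffOn_id.inv fun r hr => (mem_Ioi.1 hr).ne') hpos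
  exact (((hx.fun_mul hc).fun_add (hy.fun_mul hs)).fun_mul hinv).congr fun t ht =>
    cosLead_eq (hpos t ht)

/-- The multiplier `μ` treats straight, circular and sliding motion at once. It is quantified after
the null set, so that it may depend on `t`. -/
theorem Kinematics.ae_hasDerivAt_cosLead (hkin : E.Kinematics) (hV : ∀ i, 0 < E.V i)
    (hb : 0 ≤ b) (hp : E.InProgress b) :
    ∀ᵐ t, t ∈ Ioo 0 b → ∀ μ : ℝ, E.a i t = μ * E.circularAccel i t →
      HasDerivAt (E.cosLead i)
        (E.V i * (1 - E.cosLead i t ^ 2) * (2 * μ - 1) / E.range i t) t := by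
  filter_upwards [hkin.ae_hasDerivAt_γ (i := i) hb hp] with t ht hm μ hμ
  have hγ := ht hm
  have hpt := hp.mono hm.2.le
  have hR := hpt.range_pos (i := i) hm.1.le
  have hnh : Ici (0 : ℝ) ∈ nhds t := Ici_mem_nhds hm.1
  have hx := ((hkin.x_deriv i t hm.1.le hpt).hasDerivAt hnh).const_sub E.xT
  have hy := ((hkin.y_deriv i t hm.1.le hpt).hasDerivAt hnh).const_sub E.yT
  have hr := (hkin.hasDerivWithinAt_range (i := i) hm.1.le hpt).hasDerivAt hnh
  have hd := ((hx.fun_mul hγ.cos).fun_add (hy.fun_mul hγ.sin)).fun_mul (hr.fun_inv hR.ne')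
  refine (hd.congr_of_eventuallyEq ?_).congr_deriv ?_
  · filter_upwards [Ioo_mem_nhds hm.1 hm.2] with s hs
    exact cosLead_eq ((hp.mono hs.2.le).range_pos hs.1.le)
  · have hVi := hV i
    have hc := range_mul_cos_leadAngle (E := E) (i := i) (t := t)
    have hs := range_mul_sin_leadAngle (E := E) (i := i) (t := t)
    have hcs := sin_leadAngle_sq (E := E) (i := i) (t := t)
    have hγ1 := Real.sin_sq_add_cos_sq (E.γ i t)
    have ha : E.a i t / E.V i * E.range i t =
        2 * μ * E.V i * Real.sin (E.leadAngle i t) := by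
      rw [hμ, circularAccel]
      field_simp
    change E.range i t * E.cosLead i t = _ at hc
    rw [← hc]
    generalize E.cosLead i t = p at *
    generalize E.range i t = R at *
    generalize E.a i t / E.V i = w at *
    generalize Real.sin (E.leadAngle i t) = s at *
    generalize E.V i = v at *
    generalize Real.cos (E.γ i t) = cg at *
    generalize Real.sin (E.γ i t) = sg at *
    field_simp
    linear_combination (-v) * hγ1 - w * hs + s * ha + 2 * μ * v * hcs

/-- The applied acceleration lies between zero and that of the circular path. -/
theorem exists_accel_eq_mul {G : Digraph (Fin n)} {s c a : Fin n → ℝ} (h : GuidanceLaw G s c a)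
    (i : Fin n) : ∃ μ ∈ Icc (0 : ℝ) 1, a i = μ * c i := by
  by_cases hi : ∃ j, G.Adj i j ∧ s i < s j
  · exact ⟨0, by simp, by simp [(h i).1 hi]⟩
  · push Not at hi
    rcases (h i).2 hi with h1 | ⟨-, h1⟩
    · exact ⟨1, by simp, by simp [h1]⟩
    · rw [segment_eq_image] at h1
      obtain ⟨μ, hμ, h2⟩ := h1
      exact ⟨μ, hμ, by simpa using h2.symm⟩

end Engagement

/-! ### Estimated times under the guidance law -/

namespace Engagement

variable {n : ℕ} {E : Engagement n} {i : Fin n} {t b T : ℝ} {G : ℝ → Digraph (Fin n)}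

theorem FollowsGuidanceLaw.ae_guidanceLaw (hlaw : E.FollowsGuidanceLaw G) (hp : E.InProgress b) :
    ∀ᵐ t, t ∈ Ioo 0 b → GuidanceLaw (G t) (fun i => E.estTime i t)
      (fun i => E.circularAccel i t) (fun i => E.a i t) := by
  filter_upwards [hlaw] with t ht hm
  exact ht hm.1.le (hp.mono hm.2.le)

/-- A pursuer that does not start on the line through the target never points exactly towards or
away from the target. -/
theorem Kinematics.cosLead_mem_Ioo (hkin : E.Kinematics) (hV : ∀ i, 0 < E.V i)
    (hangle : ∀ i, E.leadAngle i 0 ≠ 0 ∧ E.leadAngle i 0 ≠ Real.pi)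
    (hlaw : E.FollowsGuidanceLaw G) (hb : 0 ≤ b) (hp : E.InProgress b) :
    E.cosLead i b ∈ Ioo (-1 : ℝ) 1 := by
  have hVi := hV i
  have hac := hkin.absolutelyContinuous_cosLead (i := i) hV hb hp
  have hpos : ∀ t ∈ Icc 0 b, 0 < E.range i t := fun t ht => (hp.mono ht.2).range_pos ht.1
  obtain ⟨t₀, ht₀, hmin⟩ := isCompact_Icc.exists_isMinOn (nonempty_Icc.2 hb)
    ((hkin.continuousOn_range (i := i)).mono Icc_subset_Ici_self)
  -- Grönwall rate: as `|p * (2 * μ - 1)| ≤ 1`, the quantity `1 - p ^ 2` decays at relative rate at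
  -- most `2 * V / R`, which is largest at the minimal range. Hence `(1 - p ^ 2) * exp (K * t)`
  -- increases and stays positive.
  set K : ℝ := 2 * E.V i / E.range i t₀
  have hsq := hac.contDiffOn_comp (h := fun p => 1 - p ^ 2) ordConnected_univ
    (by fun_prop) fun _ _ => mem_univ _
  have hexp : AbsolutelyContinuousOnInterval (fun t => Real.exp (K * t)) 0 b :=
    ContDiffOn.absolutelyContinuousOnInterval (by fun_prop)
  have hle := (hsq.fun_mul hexp).le_of_ae_hasDerivAt_nonneg hb (by
    filter_upwards [hkin.ae_hasDerivAt_cosLead (i := i) hV hb hp, hlaw.ae_guidanceLaw hp]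
      with t h1 h2 hm
    obtain ⟨μ, hμ, ha⟩ := exists_accel_eq_mul (h2 hm) i
    have hd := h1 hm μ ha
    have hd1 := ((hd.fun_pow 2).const_sub 1).fun_mul (((hasDerivAt_id t).const_mul K).exp)
    refine ⟨_, ?_, hd1⟩
    have hR := hpos t (Ioo_subset_Icc_self hm)
    have hc := cosLead_mem_Icc (E := E) (i := i) (t := t)
    have hq : 0 ≤ 1 - E.cosLead i t ^ 2 := by nlinarith [hc.1, hc.2]
    have hKR : 2 * E.V i / E.range i t ≤ K := by
      exact div_le_div_of_nonneg_left (by positivity) (hpos t₀ ht₀)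
        (hmin (Ioo_subset_Icc_self hm))
    have habs : E.cosLead i t * (2 * μ - 1) ≤ 1 := by
      have h3 : |E.cosLead i t * (2 * μ - 1)| ≤ 1 := by
        rw [abs_mul]
        exact mul_le_one₀ (abs_le.2 hc) (abs_nonneg _)
          (abs_le.2 ⟨by linarith [hμ.1], by linarith [hμ.2]⟩)
      exact (le_abs_self _).trans h3
    have hfac : 0 ≤ K - 2 * E.V i / E.range i t * (E.cosLead i t * (2 * μ - 1)) := by
      have : 0 ≤ 2 * E.V i / E.range i t := by positivity
      nlinarith
    have := mul_nonneg (mul_nonneg hq (Real.exp_pos (K * t)).le) hfac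
    refine this.trans_eq ?_
    simp only [id]
    push_cast
    field_simp
    ring)
  have h0 := one_sub_sq_pos (cosLead_zero_mem_Ioo (hangle i))
  simp only [mul_zero, Real.exp_zero, mul_one] at hle
  have := pos_of_mul_pos_left (h0.trans_le hle) (Real.exp_pos _).le
  constructor <;> nlinarith

theorem Kinematics.absolutelyContinuous_estTime_add (hkin : E.Kinematics) (hV : ∀ i, 0 < E.V i)
    (hangle : ∀ i, E.leadAngle i 0 ≠ 0 ∧ E.leadAngle i 0 ≠ Real.pi)
    (hlaw : E.FollowsGuidanceLaw G) (hb : 0 ≤ b) (hp : E.InProgress b) :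
    AbsolutelyContinuousOnInterval (fun t => E.estTime i t + t) 0 b := by
  have hF := (hkin.absolutelyContinuous_cosLead (i := i) hV hb hp).contDiffOn_comp
    ordConnected_Ioo contDiffOn_interceptFactor fun t ht => by
      rw [uIcc_of_le hb] at ht
      exact hkin.cosLead_mem_Ioo hV hangle hlaw ht.1 (hp.mono ht.2)
  have hid : AbsolutelyContinuousOnInterval (fun t : ℝ => t) 0 b :=
    ContDiffOn.absolutelyContinuousOnInterval (by fun_prop)
  refine ((((hkin.absolutelyContinuous_range (i := i) hV hb hp).fun_mul hF).const_mul
    (E.V i)⁻¹).fun_add hid).congr fun t _ => ?_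
  simp only [estTime_eq]
  ring

/-- The rate of change of the estimated time of interception. -/
theorem Kinematics.ae_hasDerivAt_estTime_add (hkin : E.Kinematics) (hV : ∀ i, 0 < E.V i)
    (hangle : ∀ i, E.leadAngle i 0 ≠ 0 ∧ E.leadAngle i 0 ≠ Real.pi)
    (hlaw : E.FollowsGuidanceLaw G) (hb : 0 ≤ b) (hp : E.InProgress b) :
    ∀ᵐ t, t ∈ Ioo 0 b → ∀ μ : ℝ, E.a i t = μ * E.circularAccel i t →
      HasDerivAt (fun t => E.estTime i t + t)
        ((2 - 2 * μ) * (1 - E.cosLead i t * interceptFactor (E.cosLead i t))) t := by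
  filter_upwards [hkin.ae_hasDerivAt_cosLead (i := i) hV hb hp] with t h1 hm μ ha
  have hVi := hV i
  have hpt := hp.mono hm.2.le
  have hmem := hkin.cosLead_mem_Ioo (i := i) hV hangle hlaw hm.1.le hpt
  have hR := hpt.range_pos (i := i) hm.1.le
  have hq := one_sub_sq_pos hmem
  have hr := (hkin.hasDerivWithinAt_range (i := i) hm.1.le hpt).hasDerivAt (Ici_mem_nhds hm.1)
  have hF := (hasDerivAt_interceptFactor hmem).comp t (h1 hm μ ha)
  simp only [estTime_eq]
  refine (((hr.fun_mul hF).div_const (E.V i)).fun_add (hasDerivAt_id t)).congr_deriv ?_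
  simp only [Function.comp_apply]
  field_simp
  ring

/-- The estimated time of interception decreases at most as fast as time elapses. -/
theorem Kinematics.monotoneOn_estTime_add (hkin : E.Kinematics) (hV : ∀ i, 0 < E.V i)
    (hangle : ∀ i, E.leadAngle i 0 ≠ 0 ∧ E.leadAngle i 0 ≠ Real.pi)
    (hlaw : E.FollowsGuidanceLaw G) (hb : 0 ≤ b) (hp : E.InProgress b) :
    MonotoneOn (fun t => E.estTime i t + t) (Icc 0 b) := by
  refine (hkin.absolutelyContinuous_estTime_add hV hangle hlaw hb
    hp).monotoneOn_of_ae_hasDerivAt_nonneg ?_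
  filter_upwards [hkin.ae_hasDerivAt_estTime_add (i := i) hV hangle hlaw hb hp,
    hlaw.ae_guidanceLaw hp] with t h1 h2 hm
  obtain ⟨μ, hμ, ha⟩ := exists_accel_eq_mul (h2 hm) i
  refine ⟨_, mul_nonneg (by linarith [hμ.2]) ?_, h1 hm μ ha⟩
  linarith [mul_interceptFactor_le_one
    (hkin.cosLead_mem_Ioo (i := i) hV hangle hlaw hm.1.le (hp.mono hm.2.le))]

theorem Kinematics.range_le_mul_estTime (hkin : E.Kinematics) (hV : ∀ i, 0 < E.V i)
    (hangle : ∀ i, E.leadAngle i 0 ≠ 0 ∧ E.leadAngle i 0 ≠ Real.pi)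
    (hlaw : E.FollowsGuidanceLaw G) (hb : 0 ≤ b) (hp : E.InProgress b) :
    E.range i b ≤ E.V i * E.estTime i b := by
  have hVi := hV i
  rw [estTime_eq, mul_div_cancel₀ _ hVi.ne']
  exact le_mul_of_one_le_right range_nonneg
    (one_le_interceptFactor (hkin.cosLead_mem_Ioo hV hangle hlaw hb hp))

/-- A pursuer with maximal estimated time moves on its circular path. -/
theorem accel_eq_of_maximal {G : Digraph (Fin n)} {s c a : Fin n → ℝ} (h : GuidanceLaw G s c a)
    (hi : ∀ j, s j ≤ s i) : a i = c i := by
  -- Sliding is excluded: the lagging pursuer at the end of the tie would share the maximal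
  -- estimated time and yet be exceeded.
  rcases (h i).2 fun j _ => hi j with h1 | ⟨⟨j, hij, k, -, hjk⟩, -⟩
  · exact h1
  · have : s i = s j := by
      clear hjk
      induction hij with
      | refl => rfl
      | tail _ h ih => exact ih.trans h.2
    linarith [hi k]

/-- The largest estimated time of interception decreases exactly as time elapses. -/
theorem Kinematics.estTime_add_le (hkin : E.Kinematics) (hV : ∀ i, 0 < E.V i)
    (hangle : ∀ i, E.leadAngle i 0 ≠ 0 ∧ E.leadAngle i 0 ≠ Real.pi)
    (hlaw : E.FollowsGuidanceLaw G) (hb : 0 ≤ b) (hp : E.InProgress b) {l : Fin n}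
    (hl : E.IsLeaderAt l 0) : E.estTime i b + b ≤ E.estTime l 0 := by
  refine le_of_ae_stationary_of_maximal (g := fun i t => E.estTime i t + t) hb
    (fun i => hkin.absolutelyContinuous_estTime_add hV hangle hlaw hb hp)
    (fun i => hkin.monotoneOn_estTime_add hV hangle hlaw hb hp) ?_
    (fun i => by simpa using hl i) i
  have hd := ae_all_iff.2 fun i : Fin n =>
    hkin.ae_hasDerivAt_estTime_add (i := i) hV hangle hlaw hb hp
  filter_upwards [hd, hlaw.ae_guidanceLaw hp] with t h1 h2 hm i hi
  have ha := accel_eq_of_maximal (h2 hm) (i := i) fun j => by simpa using hi j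
  exact (h1 i hm 1 (by simpa using ha)).congr_deriv (by ring)

/-! ### Behaviour just before an arrival -/

theorem Kinematics.tendsto_range (hkin : E.Kinematics) (hT : 0 < T) :
    Tendsto (E.range i) (nhdsWithin T (Iio T)) (nhds (E.range i T)) :=
  ((hkin.continuousOn_range.continuousAt (Ici_mem_nhds hT)).tendsto).mono_left
    nhdsWithin_le_nhds

theorem Kinematics.not_atTarget_of_le_range (hkin : E.Kinematics) (hT : 0 < T) {s c : ℝ}
    (hs : s < T) (hc : 0 < c) (h : ∀ t ∈ Ioo s T, c ≤ E.range i t) : ¬ E.AtTarget i T := by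
  rw [← range_eq_zero_iff]
  have : c ≤ E.range i T := ge_of_tendsto (hkin.tendsto_range hT) (by
    filter_upwards [Ioo_mem_nhdsLT hs] with t ht using h t ht)
  linarith

/-- The estimated time of interception of an arriving pursuer tends to zero. -/
theorem Kinematics.eventually_estTime_lt (hkin : E.Kinematics) (hV : ∀ i, 0 < E.V i)
    (hangle : ∀ i, E.leadAngle i 0 ≠ 0 ∧ E.leadAngle i 0 ≠ Real.pi)
    (hlaw : E.FollowsGuidanceLaw G) (hT : 0 < T) (hp : ∀ t ∈ Ico 0 T, E.InProgress t)
    (hi : E.AtTarget i T) {ε : ℝ} (hε : 0 < ε) :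
    ∀ᶠ t in nhdsWithin T (Iio T), E.estTime i t < ε := by
  by_contra hcon
  have hVi := hV i
  have hfr : ∃ᶠ t in nhdsWithin T (Iio T), ε ≤ E.estTime i t :=
    (not_eventually.1 hcon).mono fun t h => not_lt.1 h
  -- Within `ε / 2` of `T`, one instant with estimated time at least `ε` keeps it above `ε / 2`
  -- until `T`, since it falls no faster than time elapses.
  obtain ⟨t₁, h₁, ht₁⟩ := (hfr.and_eventually
    (Ioo_mem_nhdsLT (max_lt hT (by linarith : T - ε / 2 < T)))).exists
  have ht₁0 : 0 < t₁ := (le_max_left _ _).trans_lt ht₁.1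
  have ht₁ε : T - ε / 2 < t₁ := (le_max_right _ _).trans_lt ht₁.1
  have hlow : ∀ t ∈ Ioo t₁ T, ε / 2 < E.estTime i t := fun t ht => by
    have := hkin.monotoneOn_estTime_add (i := i) hV hangle hlaw (ht₁0.trans ht.1).le
      (hp t ⟨(ht₁0.trans ht.1).le, ht.2⟩) ⟨ht₁0.le, ht.1.le⟩
      ⟨(ht₁0.trans ht.1).le, le_rfl⟩ ht.1.le
    simp only at this
    linarith [ht.2]
  -- At such a range a positive cosine would give an estimated time below `ε / 2`, by the factor
  -- bound `π / 2`. So the cosine is nonpositive up to `T` and the range cannot decrease to zero.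
  have hsmall : ∀ᶠ t in nhdsWithin T (Iio T), E.range i t < ε * E.V i / Real.pi := by
    refine (hkin.tendsto_range hT).eventually_lt_const ?_
    rw [range_eq_zero_iff.2 hi]
    positivity
  obtain ⟨t₂, ht₂, hsub⟩ := (mem_nhdsLT_iff_exists_Ioo_subset' ht₁.2).1 hsmall
  set s := (max t₁ t₂ + T) / 2 with hs
  have hmax : max t₁ t₂ < T := max_lt ht₁.2 ht₂
  have hsT : s < T := by linarith
  have hs1 : t₁ < s := by linarith [le_max_left t₁ t₂]
  have hs2 : t₂ < s := by linarith [le_max_right t₁ t₂]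
  have hs0 : 0 < s := ht₁0.trans hs1
  have hneg : ∀ t ∈ Ico s T, E.cosLead i t ≤ 0 := fun t ht => by
    by_contra! hpos
    have hpt := hp t ⟨hs0.le.trans ht.1, ht.2⟩
    have hmem := hkin.cosLead_mem_Ioo (i := i) hV hangle hlaw (hs0.le.trans ht.1) hpt
    have h1 := hlow t ⟨hs1.trans_le ht.1, ht.2⟩
    have h2 : E.range i t < ε * E.V i / Real.pi := hsub ⟨hs2.trans_le ht.1, ht.2⟩
    rw [estTime_eq, lt_div_iff₀ hVi] at h1
    rw [lt_div_iff₀ Real.pi_pos] at h2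
    have h3 := mul_le_mul_of_nonneg_left (interceptFactor_le_pi_div_two ⟨hpos.le, hmem.2⟩)
      (range_nonneg (E := E) (i := i) (t := t))
    linarith
  refine hkin.not_atTarget_of_le_range hT hsT
    ((hp s ⟨hs0.le, hsT⟩).range_pos (i := i) hs0.le) (fun t ht => ?_) hi
  have ht0 := hs0.trans ht.1
  have hpt := hp t ⟨ht0.le, ht.2⟩
  refine ((hkin.absolutelyContinuous_range (i := i) hV ht0.le hpt).mono
    ?_).le_of_ae_hasDerivAt_nonneg ht.1.le (Eventually.of_forall fun r hr => ?_)
  · rw [uIcc_of_le ht.1.le, uIcc_of_le ht0.le]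
    exact Icc_subset_Icc hs0.le le_rfl
  · refine ⟨_, ?_, (hkin.hasDerivWithinAt_range (hs0.trans hr.1).le
      (hpt.mono hr.2.le)).hasDerivAt (Ici_mem_nhds (hs0.trans hr.1))⟩
    nlinarith [hneg r ⟨hr.1.le, hr.2.trans ht.2⟩]

/-- A pursuer that moves on a straight line does not arrive. -/
theorem Kinematics.not_atTarget_of_accel_eq_zero (hkin : E.Kinematics) (hV : ∀ i, 0 < E.V i)
    (hangle : ∀ i, E.leadAngle i 0 ≠ 0 ∧ E.leadAngle i 0 ≠ Real.pi)
    (hlaw : E.FollowsGuidanceLaw G) (hT : 0 < T) (hp : ∀ t ∈ Ico 0 T, E.InProgress t)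
    {s : ℝ} (hs : s ∈ Ico 0 T) (ha : ∀ᵐ t, t ∈ Ioo s T → E.a i t = 0) : ¬ E.AtTarget i T := by
  have hR := (hp s hs).range_pos (i := i) hs.1
  have hq := one_sub_sq_pos (hkin.cosLead_mem_Ioo (i := i) hV hangle hlaw hs.1 (hp s hs))
  -- The squared distance from the target to the line of flight; it is constant while the
  -- acceleration vanishes and bounds the squared range from below.
  have hc : 0 < E.range i s * E.range i s * (1 - E.cosLead i s ^ 2) := by positivity
  refine hkin.not_atTarget_of_le_range hT hs.2 (Real.sqrt_pos.2 hc) fun t ht => ?_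
  have ht0 := hs.1.trans_lt ht.1
  have hpt := hp t ⟨ht0.le, ht.2⟩
  have hrac := hkin.absolutelyContinuous_range (i := i) hV ht0.le hpt
  have hsq := (hkin.absolutelyContinuous_cosLead (i := i) hV ht0.le hpt).contDiffOn_comp
    (h := fun p => 1 - p ^ 2) ordConnected_univ (by fun_prop) fun _ _ => mem_univ _
  have hle := (((hrac.fun_mul hrac).fun_mul hsq).mono (by
    rw [uIcc_of_le ht.1.le, uIcc_of_le ht0.le]
    exact Icc_subset_Icc hs.1 le_rfl)).le_of_ae_hasDerivAt_nonneg ht.1.le (by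
    filter_upwards [hkin.ae_hasDerivAt_cosLead (i := i) hV ht0.le hpt, ha] with r h1 h2 hr
    have hr0 := hs.1.trans_lt hr.1
    have hd := h1 ⟨hr0, hr.2⟩ 0 (by simpa using h2 ⟨hr.1, hr.2.trans ht.2⟩)
    have hrd := (hkin.hasDerivWithinAt_range (i := i) hr0.le (hpt.mono hr.2.le)).hasDerivAt
      (Ici_mem_nhds hr0)
    have hRr := (hpt.mono hr.2.le).range_pos (i := i) hr0.le
    refine ⟨_, le_of_eq ?_, (hrd.fun_mul hrd).fun_mul ((hd.fun_pow 2).const_sub 1)⟩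
    push_cast
    field_simp
    ring)
  refine Real.sqrt_le_iff.2 ⟨range_nonneg, hle.trans ?_⟩
  rw [← sq]
  exact mul_le_of_le_one_right (sq_nonneg _) (by nlinarith [sq_nonneg (E.cosLead i t)])

/-- At the target the lead angle takes the default value `Complex.arg 0 = 0`. -/
theorem not_atTarget_zero (hangle : E.leadAngle i 0 ≠ 0) : ¬ E.AtTarget i 0 := by
  rintro ⟨h1, h2⟩
  apply hangle
  have : (⟨E.xT - E.x i 0, E.yT - E.y i 0⟩ : ℂ) = 0 := by
    apply Complex.ext <;> simp [h1, h2]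
  rw [leadAngle, this, zero_mul, Complex.arg_zero]

end Engagement

/-! ### Graph lemmas and the simultaneous arrival -/

/-- A path from a set to a point outside has an edge that leaves the set. -/
theorem Relation.ReflTransGen.exists_rel_mem_notMem {α : Type*} {r : α → α → Prop} {a b : α}
    (h : Relation.ReflTransGen r a b) {S : Set α} (ha : a ∈ S) (hb : b ∉ S) :
    ∃ c ∈ S, ∃ d ∉ S, r c d := by
  induction h with
  | refl => exact absurd ha hb
  | @tail c d _ hcd ih =>
    by_cases hc : c ∈ S
    · exact ⟨c, hc, d, hb, hcd⟩
    · exact ih hc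

/-- A switching graph is constant just before every positive time. -/
theorem IsSwitchingGraph.eventually_eq {n : ℕ} {G : ℝ → Digraph (Fin n)}
    (hG : IsSwitchingGraph G) {T : ℝ} (hT : 0 < T) :
    ∃ s ∈ Ico 0 T, ∀ t ∈ Ico s T, G t = G s := by
  obtain ⟨τ, h0, hmono, htop, hconst⟩ := hG
  have hex : ∃ z, T ≤ τ z := (htop.eventually_ge_atTop T).exists
  classical
  obtain ⟨z, hz⟩ : ∃ z, Nat.find hex = z + 1 := Nat.exists_eq_succ_of_ne_zero fun h => by
    have := Nat.find_spec hex
    rw [h, h0] at this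
    linarith
  have h1 : T ≤ τ (z + 1) := hz ▸ Nat.find_spec hex
  have h2 : τ z < T := not_le.1 (Nat.find_min hex (by omega))
  refine ⟨τ z, ⟨?_, h2⟩, fun t ht => hconst z t ⟨ht.1, ht.2.trans_le h1⟩⟩
  rw [← h0]
  exact hmono.monotone (Nat.zero_le z)

theorem mainTheorem4 {n : ℕ} (E : Engagement n) (hV : ∀ i, 0 < E.V i)
    (hkin : E.Kinematics)
    (hangle : ∀ i, E.leadAngle i 0 ≠ 0 ∧ E.leadAngle i 0 ≠ Real.pi)
    (G : ℝ → Digraph (Fin n)) (hG : IsSwitchingGraph G)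
    (hlaw : E.FollowsGuidanceLaw G)
    (l : Fin n) (hl : E.IsLeaderAt l 0)
    (hreach : ∀ t, 0 ≤ t → GloballyReachable (G t) l) :
    ∀ i, E.InterceptsAt i (E.estTime l 0) := by
  have hp0 : E.InProgress 0 := fun s hs i => by
    rw [Icc_self, mem_singleton_iff] at hs
    exact hs ▸ Engagement.not_atTarget_zero (hangle i).1
  have hpos : ∀ i t, 0 ≤ t → E.InProgress t → 0 < E.estTime i t := fun i t ht hp =>
    pos_of_mul_pos_right ((hp.range_pos ht).trans_le
      (hkin.range_le_mul_estTime (i := i) hV hangle hlaw ht hp)) (hV i).le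
  set tf := E.estTime l 0 with htf
  have htf0 : 0 < tf := hpos l 0 le_rfl hp0
  -- Otherwise the leader's estimated time at `tf` would be both positive and at most zero.
  have hnot : ¬ E.InProgress tf := fun hp => by
    linarith [hpos l tf htf0.le hp, hkin.estTime_add_le (i := l) hV hangle hlaw htf0.le hp hl]
  obtain ⟨T, ⟨⟨hT0, hTtf⟩, i₀, hi₀⟩, hTmin⟩ :
      ∃ T, IsLeast {t | t ∈ Icc 0 tf ∧ ∃ i, E.AtTarget i t} T := by
    refine IsCompact.exists_isLeast ?_ ?_
    · have : {t | t ∈ Icc 0 tf ∧ ∃ i, E.AtTarget i t} =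
          ⋃ i, Icc 0 tf ∩ E.range i ⁻¹' {0} := by
        ext t
        simp [Engagement.range_eq_zero_iff]
      rw [this]
      exact isCompact_iUnion fun i => isCompact_Icc.of_isClosed_subset
        ((hkin.continuousOn_range.mono Icc_subset_Ici_self).preimage_isClosed_of_isClosed
          isClosed_Icc isClosed_singleton) inter_subset_left
    · by_contra hemp
      exact hnot fun s hs i hi => hemp ⟨s, hs, i, hi⟩
  have hp : ∀ t ∈ Ico 0 T, E.InProgress t := fun t ht s hs i hi =>
    absurd (hTmin ⟨⟨hs.1, (hs.2.trans ht.2.le).trans hTtf⟩, i, hi⟩)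
      (not_le.2 (hs.2.trans_lt ht.2))
  have hT : 0 < T := hT0.lt_of_ne fun h => hp0 0 (by simp) i₀ (h ▸ hi₀)
  have hT_eq : T = tf := by
    by_contra hne
    have hlt : T < tf := hTtf.lt_of_ne hne
    have hl_not : ¬ E.AtTarget l T := fun hat => by
      obtain ⟨t, h1, ht⟩ := ((hkin.eventually_estTime_lt hV hangle hlaw hT hp hat
        (sub_pos.2 hlt)).and (Ioo_mem_nhdsLT hT)).exists
      have := hkin.monotoneOn_estTime_add (i := l) hV hangle hlaw ht.1.le (hp t ⟨ht.1.le, ht.2⟩)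
        ⟨le_rfl, ht.1.le⟩ ⟨ht.1.le, le_rfl⟩ ht.1.le
      simp only at this
      linarith [ht.2]
    obtain ⟨s, hs, hconst⟩ := hG.eventually_eq hT
    -- The path from an arriving pursuer to the leader leaves the set of arrivals along some edge.
    obtain ⟨i, hi, k, hk, hadj⟩ := (hreach s hs.1 i₀).exists_rel_mem_notMem
      (S := {i | E.AtTarget i T}) hi₀ hl_not
    have hRk : 0 < E.range k T := Engagement.range_pos hk
    have hVk := hV k
    have hev : ∀ᶠ t in nhdsWithin T (Iio T), E.estTime i t < E.estTime k t := by
      filter_upwards [hkin.eventually_estTime_lt hV hangle hlaw hT hp hi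
          -- Near `T` the range of `k` exceeds half its value at `T`, so this `ε` lies below the
          -- estimated time of `k`.
          (ε := E.range k T / 2 / E.V k) (by positivity),
        (hkin.tendsto_range (i := k) hT).eventually_const_lt (half_lt_self hRk),
        Ioo_mem_nhdsLT hT] with t h1 h2 ht
      have h3 := hkin.range_le_mul_estTime (i := k) hV hangle hlaw ht.1.le
        (hp t ⟨ht.1.le, ht.2⟩)
      rw [lt_div_iff₀ hVk] at h1
      nlinarith
    obtain ⟨r, hr, hsub⟩ := (mem_nhdsLT_iff_exists_Ioo_subset' hs.2).1 hev
    refine hkin.not_atTarget_of_accel_eq_zero hV hangle hlaw hT hp (s := max s r)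
      ⟨hs.1.trans (le_max_left _ _), max_lt hs.2 hr⟩ ?_ hi
    filter_upwards [hlaw] with t ht hm
    have hst : s < t := (le_max_left _ _).trans_lt hm.1
    have hrt : r < t := (le_max_right _ _).trans_lt hm.1
    have ht0 := hs.1.trans hst.le
    exact ((ht ht0 (hp t ⟨ht0, hm.2⟩)) i).1
      ⟨k, by rw [hconst t ⟨hst.le, hm.2⟩]; exact hadj, hsub ⟨hrt, hm.2⟩⟩
  rw [hT_eq] at hp hT
  refine fun i => ⟨htf0.le, ?_, fun s hs => hp s hs s ⟨hs.1, le_rfl⟩ i⟩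
  rw [← Engagement.range_eq_zero_iff]
  refine le_antisymm ?_ Engagement.range_nonneg
  have hlim : Tendsto (fun t => E.V i * (tf - t)) (nhdsWithin tf (Iio tf)) (nhds 0) := by
    have : ContinuousAt (fun t => E.V i * (tf - t)) tf := by fun_prop
    simpa [ContinuousAt] using this.tendsto.mono_left nhdsWithin_le_nhds
  -- The bound `R ≤ V * (tf - t)` forces every range to zero at `tf`.
  refine le_of_tendsto_of_tendsto (hkin.tendsto_range hT) hlim ?_
  filter_upwards [Ioo_mem_nhdsLT hT] with t ht
  have hpt := hp t ⟨ht.1.le, ht.2⟩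
  refine (hkin.range_le_mul_estTime hV hangle hlaw ht.1.le hpt).trans ?_
  have := hkin.estTime_add_le (i := i) hV hangle hlaw ht.1.le hpt hl
  exact mul_le_mul_of_nonneg_left (by linarith) (hV i).le
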